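/- Let $\mathbb K$ be $\mathbb R$ or $\mathbb C$. For Banach spaces $X_1,\dots,X_n$ over $\mathbb K$ ($n\ge 1$) let $\Sigma_{X_1\dots X_n}=\{x^1\otimes\cdots\otimes x^n : x^i\in X_i\}\subset X_1\otimes\cdots\otimes X_n$. A reasonable crossnorm on $X_1\otimes\cdots\otimes X_n$ is a norm $\beta$ with $\varepsilon\le\beta\le\pi$, where $\varepsilon,\pi$ are the injective and projective tensor norms; for subspaces $E_i\subset X_i$ its restriction to $E_1\otimes\cdots\otimes E_n$ is denoted $\beta|$. For a bounded multilinear operator $T:X_1\times\cdots\times X_n\to Y$ let $\tilde T$ be its linearization and $f_T=\tilde T|_{\Sigma_{X_1\dots X_n}}$. Let $\mathcal L^\beta(X_1,\dots,X_n)$ be the space of multilinear forms $\varphi$ whose linearization is bounded on $(X_1\otimes\cdots\otimes X_n,\beta)$, with $\|\varphi\|_\beta=\|\tilde\varphi\|$. A $\Sigma$-ideal $[\mathcal A,A]$ assigns to all $n\ge1$, all Banach spaces $X_1,\dots,X_n,Y$ over $\mathbb K$ and every reasonable crossnorm $\beta$ on $X_1\otimes\cdots\otimes X_n$ a linear subspace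 $\mathcal A^\beta(X_1,\dots,X_n;Y)$ of the space $\mathcal L(X_1,\dots,X_n;Y)$ of bounded multilinear operators, with a complete norm $A^\beta$ on it, such that: 1. $\varphi\cdot y\in\mathcal A^\beta(X_1,\dots,X_n;Y)$ and $A^\beta(\varphi\cdot y)\le\|\varphi\|_\beta\|y\|$ for all $\varphi\in\mathcal L^\beta(X_1,\dots,X_n)$ and $y\in Y$; 2. $\|f_T(p)-f_T(q)\|\le A^\beta(T)\,\beta(p-q)$ for all $T\in\mathcal A^\beta(X_1,\dots,X_n;Y)$ and $p,q\in\Sigma_{X_1\dots X_n}$; 3. if $T\in\mathcal A^\beta(X_1,\dots,X_n;Y)$, $S:Y\to W$ is a bounded linear operator between Banach spaces, $\theta$ is a reasonable crossnorm on $Z_1\otimes\cdots\otimes Z_m$ ($Z_j$ Banach spaces, $m\ge1$), and $R:Z_1\times\cdots\times Z_m\to X_1\otimes\cdots\otimes X_n$ is a multilinear map whose linearization $\tilde R:(Z_1\otimes\cdots\otimes Z_m,\theta)\to(X_1\otimes\cdots\otimes X_n,\beta)$ is bounded and maps $\Sigma_{Z_1\dots Z_m}$ into $\Sigma_{X_1\dots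 X_n}$, then $Sf_TR\in\mathcal A^\theta(Z_1,\dots,Z_m;W)$ and $A^\theta(Sf_TR)\le\|\tilde R\|\,A^\beta(T)\,\|S\|$. For $T\in\mathcal L(X_1,\dots,X_n;Y)$ put $$A^{\max,\beta}(T)=\sup A^{\beta|}\bigl(Q_L\circ T|_{E_1\times\cdots\times E_n}:E_1\times\cdots\times E_n\to Y/L\bigr)\in[0,\infty],$$ the supremum being over all finite dimensional subspaces $E_i\subset X_i$ and all closed finite codimensional subspaces $L\subset Y$, where $Q_L:Y\to Y/L$ is the quotient map. The $\Sigma$-ideal $[\mathcal A,A]$ is maximal if it coincides with its maximal hull, i.e. if for all $n$, $X_i$, $Y$, $\beta$ and all $T\in\mathcal L(X_1,\dots,X_n;Y)$ one has $T\in\mathcal A^\beta(X_1,\dots,X_n;Y)$ if and only if $A^{\max,\beta}(T)<\infty$, and in that case $A^\beta(T)=A^{\max,\beta}(T)$. **Proposition.** Let $[\mathcal A,A]$ be a maximal $\Sigma$-ideal, $n\ge 1$, $X_1,\dots,X_n,Y$ Banach spaces, $\beta$ a reasonable crossnorm on $X_1\otimes\cdots\otimes X_n$, and $T\in\mathcal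 L(X_1,\dots,X_n;Y)$. Let $K_Y:Y\to Y^{**}$ be the canonical embedding. Then $T\in\mathcal A^\beta(X_1,\dots,X_n;Y)$ if and only if $K_YT\in\mathcal A^\beta(X_1,\dots,X_n;Y^{**})$, and in that case $A^\beta(T)=A^\beta(K_YT)$. -/

import Mathlib

open scoped TensorProduct ENNReal

universe u

namespace SigmaIdeals

/-! ## Tensor products of Banach spaces, the Segre cone, and reasonable crossnorms -/

section Tensor

variable {𝕜 : Type} [RCLike 𝕜] {n : ℕ}
  {X : Fin n → Type u} [∀ i, NormedAddCommGroup (X i)] [∀ i, NormedSpace 𝕜 (X i)]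

/-- The `n`-linear form `(x¹, …, xⁿ) ↦ x₁*(x¹) ⋯ xₙ*(xⁿ)`. -/
noncomputable def dualForm (f : ∀ i, StrongDual 𝕜 (X i)) : ContinuousMultilinearMap 𝕜 X 𝕜 :=
  (ContinuousMultilinearMap.mkPiAlgebra 𝕜 (Fin n) 𝕜).compContinuousLinearMap f

@[simp]
theorem dualForm_apply (f : ∀ i, StrongDual 𝕜 (X i)) (x : ∀ i, X i) :
    dualForm f x = ∏ i, f i (x i) := by
  simp [dualForm]

/-- The linearization `X₁ ⊗ ⋯ ⊗ Xₙ → Y` of a multilinear operator `T : X₁ × ⋯ × Xₙ → Y`. -/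
noncomputable def linearization {Y : Type*} [NormedAddCommGroup Y] [NormedSpace 𝕜 Y]
    (T : ContinuousMultilinearMap 𝕜 X Y) : (⨂[𝕜] i, X i) →ₗ[𝕜] Y :=
  PiTensorProduct.lift T.toMultilinearMap

@[simp]
theorem linearization_tprod {Y : Type*} [NormedAddCommGroup Y] [NormedSpace 𝕜 Y]
    (T : ContinuousMultilinearMap 𝕜 X Y) (x : ∀ i, X i) :
    linearization T (PiTensorProduct.tprod 𝕜 x) = T x := by
  simp [linearization]

variable (𝕜 X) in
/-- The set `Σ_{X₁ … Xₙ}` of decomposable tensors `x¹ ⊗ ⋯ ⊗ xⁿ`. -/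
def segreCone : Set (⨂[𝕜] i, X i) :=
  Set.range fun x : ∀ i, X i => PiTensorProduct.tprod 𝕜 x

/-- The `Σ`-operator `f_T : Σ_{X₁ … Xₙ} → Y` associated with `T`: the restriction of the
linearization of `T` to the decomposable tensors. -/
noncomputable def sigmaOp {Y : Type*} [NormedAddCommGroup Y] [NormedSpace 𝕜 Y]
    (T : ContinuousMultilinearMap 𝕜 X Y) : segreCone 𝕜 X → Y :=
  fun p => linearization T p

/-- The injective tensor norm
`ε(u) = sup {|(x₁* ⊗ ⋯ ⊗ xₙ*)(u)| : ‖xᵢ*‖ ≤ 1}`. -/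
noncomputable def injectiveNorm (u : ⨂[𝕜] i, X i) : ℝ :=
  ⨆ f : {f : ∀ i, StrongDual 𝕜 (X i) // ∀ i, ‖f i‖ ≤ 1}, ‖linearization (dualForm f.1) u‖

theorem norm_dualForm_le_one (f : ∀ i, StrongDual 𝕜 (X i)) (hf : ∀ i, ‖f i‖ ≤ 1) :
    ‖dualForm f‖ ≤ 1 := by
  refine ContinuousMultilinearMap.opNorm_le_bound zero_le_one fun x => ?_
  rw [dualForm_apply, norm_prod, one_mul]
  exact Finset.prod_le_prod (fun _ _ => norm_nonneg _) fun i _ =>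
    ((f i).le_opNorm (x i)).trans (mul_le_of_le_one_left (norm_nonneg _) (hf i))

theorem bddAbove_injectiveNorm (u : ⨂[𝕜] i, X i) :
    BddAbove (Set.range fun f : {f : ∀ i, StrongDual 𝕜 (X i) // ∀ i, ‖f i‖ ≤ 1} =>
      ‖linearization (dualForm f.1) u‖) := by
  refine ⟨‖u‖, ?_⟩
  rintro _ ⟨f, rfl⟩
  exact (PiTensorProduct.norm_eval_le_projectiveSeminorm (dualForm f.1) u).trans
    (mul_le_of_le_one_left (norm_nonneg _) (norm_dualForm_le_one f.1 f.2))

theorem le_injectiveNorm (f : ∀ i, StrongDual 𝕜 (X i)) (hf : ∀ i, ‖f i‖ ≤ 1)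
    (u : ⨂[𝕜] i, X i) : ‖linearization (dualForm f) u‖ ≤ injectiveNorm u :=
  le_ciSup (bddAbove_injectiveNorm u) ⟨f, hf⟩

theorem prod_norm_le_injectiveNorm (x : ∀ i, X i) :
    ∏ i, ‖x i‖ ≤ injectiveNorm (PiTensorProduct.tprod 𝕜 x) := by
  choose f hf hfx using fun i => exists_dual_vector'' 𝕜 (x i)
  have h := le_injectiveNorm f hf (PiTensorProduct.tprod 𝕜 x)
  simpa [hfx, norm_prod] using h

variable (𝕜 X) in
/-- A reasonable crossnorm on `X₁ ⊗ ⋯ ⊗ Xₙ`: a norm `β` with `ε ≤ β ≤ π`. -/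
structure ReasonableCrossnorm where
  /-- the norm, as a real function on the algebraic tensor product -/
  toSeminorm : Seminorm 𝕜 (⨂[𝕜] i, X i)
  eq_zero_of_apply_eq_zero : ∀ u, toSeminorm u = 0 → u = 0
  injective_le : ∀ u, injectiveNorm u ≤ toSeminorm u
  le_projective : ∀ u, toSeminorm u ≤ PiTensorProduct.projectiveSeminorm u

instance : CoeFun (ReasonableCrossnorm 𝕜 X) fun _ => (⨂[𝕜] i, X i) → ℝ :=
  ⟨fun β => β.toSeminorm⟩

/-- The inclusion `E₁ ⊗ ⋯ ⊗ Eₙ → X₁ ⊗ ⋯ ⊗ Xₙ` for subspaces `Eᵢ` of `Xᵢ`. -/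
noncomputable def tensorIncl (E : ∀ i, Submodule 𝕜 (X i)) :
    (⨂[𝕜] i, E i) →ₗ[𝕜] (⨂[𝕜] i, X i) :=
  PiTensorProduct.map fun i => (E i).subtype

theorem tensorIncl_injective (E : ∀ i, Submodule 𝕜 (X i)) :
    Function.Injective (tensorIncl E) := by
  choose g hg using fun i =>
    (E i).subtype.exists_leftInverse_of_injective (Submodule.ker_subtype _)
  have h : (PiTensorProduct.map g).comp (tensorIncl E) = LinearMap.id := by
    rw [tensorIncl, ← PiTensorProduct.map_comp]
    simp [hg]
  exact Function.LeftInverse.injective (g := PiTensorProduct.map g)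
    fun u => LinearMap.congr_fun h u

theorem injectiveNorm_le_tensorIncl (E : ∀ i, Submodule 𝕜 (X i)) (u : ⨂[𝕜] i, E i) :
    injectiveNorm u ≤ injectiveNorm (tensorIncl E u) := by
  have : Nonempty {f : ∀ i, StrongDual 𝕜 (E i) // ∀ i, ‖f i‖ ≤ 1} := ⟨⟨0, by simp⟩⟩
  refine ciSup_le fun f => ?_
  choose g hg hgn using fun i => exists_extension_norm_eq (E i) (f.1 i)
  have h : linearization (dualForm f.1) = (linearization (dualForm g)).comp (tensorIncl E) := by
    ext x
    simp [tensorIncl, hg]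
  rw [h]
  exact le_injectiveNorm g (fun i => (hgn i).trans_le (f.2 i)) _

theorem tensorIncl_le_projective (E : ∀ i, Submodule 𝕜 (X i)) (u : ⨂[𝕜] i, E i) :
    PiTensorProduct.projectiveSeminorm (tensorIncl E u)
      ≤ PiTensorProduct.projectiveSeminorm u := by
  have h := (PiTensorProduct.mapL fun i => (E i).subtypeL).le_opNorm u
  have h1 : ‖PiTensorProduct.mapL fun i => (E i).subtypeL‖ ≤ 1 :=
    (PiTensorProduct.opNorm_mapL _).trans
      (Finset.prod_le_one (fun _ _ => norm_nonneg _) fun i _ => (E i).norm_subtypeL_le)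
  have h2 := h.trans (mul_le_of_le_one_left (norm_nonneg u) h1)
  rwa [PiTensorProduct.mapL_apply] at h2

/-- The restriction `β|` of a reasonable crossnorm to `E₁ ⊗ ⋯ ⊗ Eₙ`. -/
noncomputable def ReasonableCrossnorm.restrict (β : ReasonableCrossnorm 𝕜 X)
    (E : ∀ i, Submodule 𝕜 (X i)) : ReasonableCrossnorm 𝕜 (fun i => E i) where
  toSeminorm := β.toSeminorm.comp (tensorIncl E)
  eq_zero_of_apply_eq_zero u hu :=
    tensorIncl_injective E (by rw [β.eq_zero_of_apply_eq_zero _ hu, map_zero])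
  injective_le u := (injectiveNorm_le_tensorIncl E u).trans (β.injective_le _)
  le_projective u := (β.le_projective _).trans (tensorIncl_le_projective E u)

end Tensor

/-! ## Linear maps that are bounded with respect to given seminorms -/

section Bounded

variable {𝕜 : Type} [RCLike 𝕜] {V W : Type*} [AddCommGroup V] [Module 𝕜 V]
  [AddCommGroup W] [Module 𝕜 W]

/-- `f : (V, p) → (W, q)` is bounded. -/
def IsBoundedWrt (p : Seminorm 𝕜 V) (q : Seminorm 𝕜 W) (f : V →ₗ[𝕜] W) : Prop :=
  ∃ C : ℝ, 0 ≤ C ∧ ∀ v, q (f v) ≤ C * p v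

/-- The operator norm of `f : (V, p) → (W, q)`; meaningful if `f` is bounded. -/
noncomputable def opNormWrt (p : Seminorm 𝕜 V) (q : Seminorm 𝕜 W) (f : V →ₗ[𝕜] W) : ℝ :=
  sInf {C : ℝ | 0 ≤ C ∧ ∀ v, q (f v) ≤ C * p v}

end Bounded

/-! ## The space of `β`-bounded forms, and `Σ`-`β`-`θ`-operators -/

section Operators

variable {𝕜 : Type} [RCLike 𝕜] {n m : ℕ}
  {X : Fin n → Type u} [∀ i, NormedAddCommGroup (X i)] [∀ i, NormedSpace 𝕜 (X i)]
  {Z : Fin m → Type u} [∀ i, NormedAddCommGroup (Z i)] [∀ i, NormedSpace 𝕜 (Z i)]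
  {Y : Type u} [NormedAddCommGroup Y] [NormedSpace 𝕜 Y]
  {W : Type u} [NormedAddCommGroup W] [NormedSpace 𝕜 W]

/-- `φ ∈ 𝓛^β(X₁, …, Xₙ)`: the linearization of the multilinear form `φ` is bounded on
`(X₁ ⊗ ⋯ ⊗ Xₙ, β)`. -/
def IsBetaBounded (β : ReasonableCrossnorm 𝕜 X) (φ : ContinuousMultilinearMap 𝕜 X 𝕜) : Prop :=
  IsBoundedWrt β.toSeminorm (normSeminorm 𝕜 𝕜) (linearization φ)

/-- The norm `‖φ‖_β` of `φ ∈ 𝓛^β(X₁, …, Xₙ)`. -/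
noncomputable def betaNorm (β : ReasonableCrossnorm 𝕜 X)
    (φ : ContinuousMultilinearMap 𝕜 X 𝕜) : ℝ :=
  opNormWrt β.toSeminorm (normSeminorm 𝕜 𝕜) (linearization φ)

/-- A `Σ`-`β`-`θ`-operator: a multilinear map `R : Z₁ × ⋯ × Z_m → X₁ ⊗ ⋯ ⊗ Xₙ` whose
linearization `(Z₁ ⊗ ⋯ ⊗ Z_m, θ) → (X₁ ⊗ ⋯ ⊗ Xₙ, β)` is bounded and maps decomposable
tensors to decomposable tensors. -/
structure SigmaOperator (θ : ReasonableCrossnorm 𝕜 Z) (β : ReasonableCrossnorm 𝕜 X) where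
  /-- the multilinear map `R` -/
  toMultilinearMap : MultilinearMap 𝕜 Z (⨂[𝕜] i, X i)
  bounded : IsBoundedWrt θ.toSeminorm β.toSeminorm (PiTensorProduct.lift toMultilinearMap)
  mapsTo_segreCone :
    Set.MapsTo (PiTensorProduct.lift toMultilinearMap) (segreCone 𝕜 Z) (segreCone 𝕜 X)

namespace SigmaOperator

variable {θ : ReasonableCrossnorm 𝕜 Z} {β : ReasonableCrossnorm 𝕜 X}

/-- The norm `‖R̃‖` of the linearization of `R` between `(Z₁ ⊗ ⋯ ⊗ Z_m, θ)` and
`(X₁ ⊗ ⋯ ⊗ Xₙ, β)`. -/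
noncomputable def norm (R : SigmaOperator θ β) : ℝ :=
  opNormWrt θ.toSeminorm β.toSeminorm (PiTensorProduct.lift R.toMultilinearMap)

theorem exists_bound (R : SigmaOperator θ β) (T : ContinuousMultilinearMap 𝕜 X Y)
    (S : Y →L[𝕜] W) :
    ∃ C : ℝ, ∀ z, ‖S (linearization T (R.toMultilinearMap z))‖ ≤ C * ∏ i, ‖z i‖ := by
  obtain ⟨C, hC, hR⟩ := R.bounded
  refine ⟨‖S‖ * (‖T‖ * C), fun z => ?_⟩
  have hz : R.toMultilinearMap z ∈ segreCone 𝕜 X := by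
    have := R.mapsTo_segreCone (x := PiTensorProduct.tprod 𝕜 z) ⟨z, rfl⟩
    rwa [PiTensorProduct.lift.tprod] at this
  obtain ⟨x, hx⟩ := hz
  have hx' : PiTensorProduct.tprod 𝕜 x = R.toMultilinearMap z := hx
  have h1 : ∏ i, ‖x i‖ ≤ C * ∏ i, ‖z i‖ := by
    refine (prod_norm_le_injectiveNorm (𝕜 := 𝕜) x).trans ((β.injective_le _).trans ?_)
    have h := hR (PiTensorProduct.tprod 𝕜 z)
    rw [PiTensorProduct.lift.tprod] at h
    rw [hx']
    exact h.trans (mul_le_mul_of_nonneg_left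
      ((θ.le_projective _).trans (PiTensorProduct.projectiveSeminorm_tprod_le z)) hC)
  rw [← hx', linearization_tprod, mul_assoc, mul_assoc]
  refine (S.le_opNorm _).trans (mul_le_mul_of_nonneg_left ?_ (norm_nonneg _))
  exact (T.le_opNorm x).trans (mul_le_mul_of_nonneg_left h1 (norm_nonneg _))

/-- The multilinear operator `S f_T R : Z₁ × ⋯ × Z_m → W`, as a bounded multilinear operator. -/
noncomputable def sandwich (R : SigmaOperator θ β) (T : ContinuousMultilinearMap 𝕜 X Y)
    (S : Y →L[𝕜] W) : ContinuousMultilinearMap 𝕜 Z W where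
  toMultilinearMap :=
    ((S : Y →ₗ[𝕜] W).comp (linearization T)).compMultilinearMap R.toMultilinearMap
  cont := MultilinearMap.continuous_of_bound
    (((S : Y →ₗ[𝕜] W).comp (linearization T)).compMultilinearMap R.toMultilinearMap)
    (R.exists_bound T S).choose (R.exists_bound T S).choose_spec

end SigmaOperator

/-- The multilinear operator `Q_L T (I_{E₁} × ⋯ × I_{Eₙ}) : E₁ × ⋯ × Eₙ → Y/L`. -/
noncomputable def compress (T : ContinuousMultilinearMap 𝕜 X Y)
    (E : ∀ i, Submodule 𝕜 (X i)) (L : Submodule 𝕜 Y) :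
    ContinuousMultilinearMap 𝕜 (fun i => E i) (Y ⧸ L) :=
  L.mkQL.compContinuousMultilinearMap
    (T.compContinuousLinearMap fun i => (E i).subtypeL)

end Operators

/-! ## `Σ`-ideals -/

/-- A `Σ`-ideal `[𝒜, A]` of multilinear operators on the class of Banach spaces over `𝕜`: to every
positive integer `n`, Banach spaces `X₁, …, Xₙ, Y` and reasonable crossnorm `β` on
`X₁ ⊗ ⋯ ⊗ Xₙ` it assigns a linear subspace of the bounded multilinear operators with a
complete norm, subject to the three properties at the end. -/
structure SigmaIdeal (𝕜 : Type) [RCLike 𝕜] where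
  /-- the component `𝒜^β(X₁, …, Xₙ; Y)` -/
  comp : ∀ {n : ℕ} [NeZero n] {X : Fin n → Type u} [∀ i, NormedAddCommGroup (X i)]
    [∀ i, NormedSpace 𝕜 (X i)] [∀ i, CompleteSpace (X i)] (_β : ReasonableCrossnorm 𝕜 X)
    (Y : Type u) [NormedAddCommGroup Y] [NormedSpace 𝕜 Y] [CompleteSpace Y],
    Submodule 𝕜 (ContinuousMultilinearMap 𝕜 X Y)
  /-- the norm `A^β` on the component -/
  norm : ∀ {n : ℕ} [NeZero n] {X : Fin n → Type u} [∀ i, NormedAddCommGroup (X i)]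
    [∀ i, NormedSpace 𝕜 (X i)] [∀ i, CompleteSpace (X i)] (β : ReasonableCrossnorm 𝕜 X)
    (Y : Type u) [NormedAddCommGroup Y] [NormedSpace 𝕜 Y] [CompleteSpace Y],
    Seminorm 𝕜 (comp β Y)
  eq_zero_of_norm_eq_zero : ∀ {n : ℕ} [NeZero n] {X : Fin n → Type u}
    [∀ i, NormedAddCommGroup (X i)] [∀ i, NormedSpace 𝕜 (X i)] [∀ i, CompleteSpace (X i)]
    (β : ReasonableCrossnorm 𝕜 X)
    (Y : Type u) [NormedAddCommGroup Y] [NormedSpace 𝕜 Y] [CompleteSpace Y]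
    (T : comp β Y), norm β Y T = 0 → T = 0
  /-- every `A^β`-Cauchy sequence of the component is `A^β`-convergent in it -/
  complete : ∀ {n : ℕ} [NeZero n] {X : Fin n → Type u}
    [∀ i, NormedAddCommGroup (X i)] [∀ i, NormedSpace 𝕜 (X i)] [∀ i, CompleteSpace (X i)]
    (β : ReasonableCrossnorm 𝕜 X)
    (Y : Type u) [NormedAddCommGroup Y] [NormedSpace 𝕜 Y] [CompleteSpace Y]
    (T : ℕ → comp β Y),
    (∀ ε : ℝ, 0 < ε → ∃ N, ∀ k l, N ≤ k → N ≤ l → norm β Y (T k - T l) < ε) →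
    ∃ T₀ : comp β Y, ∀ ε : ℝ, 0 < ε → ∃ N, ∀ k, N ≤ k → norm β Y (T k - T₀) < ε
  /-- Every `φ · y` with `φ ∈ 𝓛^β(X₁, …, Xₙ)` and `y ∈ Y` is in the component, and
  `A^β(φ · y) ≤ ‖φ‖_β ‖y‖` -/
  rankOne : ∀ {n : ℕ} [NeZero n] {X : Fin n → Type u}
    [∀ i, NormedAddCommGroup (X i)] [∀ i, NormedSpace 𝕜 (X i)] [∀ i, CompleteSpace (X i)]
    (β : ReasonableCrossnorm 𝕜 X)
    (Y : Type u) [NormedAddCommGroup Y] [NormedSpace 𝕜 Y] [CompleteSpace Y]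
    (φ : ContinuousMultilinearMap 𝕜 X 𝕜) (y : Y), IsBetaBounded β φ →
    ∃ h : φ.smulRight y ∈ comp β Y, norm β Y ⟨φ.smulRight y, h⟩ ≤ betaNorm β φ * ‖y‖
  /-- `Lip^β(f_T) ≤ A^β(T)` -/
  lipschitz : ∀ {n : ℕ} [NeZero n] {X : Fin n → Type u}
    [∀ i, NormedAddCommGroup (X i)] [∀ i, NormedSpace 𝕜 (X i)] [∀ i, CompleteSpace (X i)]
    (β : ReasonableCrossnorm 𝕜 X)
    (Y : Type u) [NormedAddCommGroup Y] [NormedSpace 𝕜 Y] [CompleteSpace Y]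
    (T : comp β Y) (p q : segreCone 𝕜 X),
    ‖sigmaOp T.1 p - sigmaOp T.1 q‖ ≤ norm β Y T * β (p.1 - q.1)
  /-- Ideal property: `S f_T R` is in the component `𝒜^θ(Z₁, …, Z_m; W)`, and
  `A^θ(S f_T R) ≤ ‖R̃‖ A^β(T) ‖S‖` -/
  ideal : ∀ {n : ℕ} [NeZero n] {X : Fin n → Type u}
    [∀ i, NormedAddCommGroup (X i)] [∀ i, NormedSpace 𝕜 (X i)] [∀ i, CompleteSpace (X i)]
    (β : ReasonableCrossnorm 𝕜 X)
    (Y : Type u) [NormedAddCommGroup Y] [NormedSpace 𝕜 Y] [CompleteSpace Y]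
    {m : ℕ} [NeZero m] {Z : Fin m → Type u}
    [∀ i, NormedAddCommGroup (Z i)] [∀ i, NormedSpace 𝕜 (Z i)] [∀ i, CompleteSpace (Z i)]
    (θ : ReasonableCrossnorm 𝕜 Z)
    (W : Type u) [NormedAddCommGroup W] [NormedSpace 𝕜 W] [CompleteSpace W]
    (R : SigmaOperator θ β) (T : comp β Y) (S : Y →L[𝕜] W),
    ∃ h : R.sandwich T.1 S ∈ comp θ W,
      norm θ W ⟨R.sandwich T.1 S, h⟩ ≤ R.norm * norm β Y T * ‖S‖

namespace SigmaIdeal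

variable {𝕜 : Type} [RCLike 𝕜] (𝒜 : SigmaIdeal.{u} 𝕜) {n : ℕ} [NeZero n]
  {X : Fin n → Type u} [∀ i, NormedAddCommGroup (X i)] [∀ i, NormedSpace 𝕜 (X i)]
  {Y : Type u} [NormedAddCommGroup Y] [NormedSpace 𝕜 Y] [CompleteSpace Y]

open Classical in
/-- The ideal norm extended to all bounded multilinear operators by `A^β(T) = ∞` for `T` outside
the component. -/
noncomputable def extNorm [∀ i, CompleteSpace (X i)] (β : ReasonableCrossnorm 𝕜 X)
    (T : ContinuousMultilinearMap 𝕜 X Y) : ℝ≥0∞ :=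
  if h : T ∈ 𝒜.comp β Y then ENNReal.ofReal (𝒜.norm β Y ⟨T, h⟩) else ∞

/-- `A^{β|}(Q_L f_T I_{E₁ … Eₙ} : E₁ × ⋯ × Eₙ → Y/L)` for finite dimensional `Eᵢ` and closed `L`. -/
noncomputable def compressNorm (β : ReasonableCrossnorm 𝕜 X)
    (T : ContinuousMultilinearMap 𝕜 X Y) (E : ∀ i, Submodule 𝕜 (X i))
    (hE : ∀ i, FiniteDimensional 𝕜 (E i)) (L : Submodule 𝕜 Y) (hL : IsClosed (L : Set Y)) :
    ℝ≥0∞ :=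
  haveI : ∀ i, CompleteSpace (E i) := fun i => haveI := hE i; FiniteDimensional.complete 𝕜 (E i)
  haveI := hL
  𝒜.extNorm (β.restrict E) (compress T E L)

/-- The norm of the maximal hull: `A^{max,β}(T) = sup A^{β|}(Q_L f_T I_{E₁ … Eₙ})`, the supremum
over all finite dimensional subspaces `Eᵢ` of `Xᵢ` and all closed finite codimensional subspaces
`L` of `Y`. -/
noncomputable def maxNorm (β : ReasonableCrossnorm 𝕜 X)
    (T : ContinuousMultilinearMap 𝕜 X Y) : ℝ≥0∞ :=
  ⨆ (E : ∀ i, Submodule 𝕜 (X i)) (hE : ∀ i, FiniteDimensional 𝕜 (E i))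
    (L : Submodule 𝕜 Y) (hL : IsClosed (L : Set Y)) (_ : FiniteDimensional 𝕜 (Y ⧸ L)),
    𝒜.compressNorm β T E hE L hL

/-- `[𝒜, A]` is maximal if it coincides with its maximal hull: a bounded multilinear operator `T`
is in the component if and only if `A^{max,β}(T) < ∞`, and then `A^β(T) = A^{max,β}(T)`. -/
def IsMaximal : Prop :=
  ∀ (n : ℕ) [NeZero n] (X : Fin n → Type u)
    [∀ i, NormedAddCommGroup (X i)] [∀ i, NormedSpace 𝕜 (X i)] [∀ i, CompleteSpace (X i)]
    (β : ReasonableCrossnorm 𝕜 X)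
    (Y : Type u) [NormedAddCommGroup Y] [NormedSpace 𝕜 Y] [CompleteSpace Y]
    (T : ContinuousMultilinearMap 𝕜 X Y),
    (T ∈ 𝒜.comp β Y ↔ 𝒜.maxNorm β T < ∞) ∧
      ∀ h : T ∈ 𝒜.comp β Y, ENNReal.ofReal (𝒜.norm β Y ⟨T, h⟩) = 𝒜.maxNorm β T

end SigmaIdeal

end SigmaIdeals

/-!
Composing with the contraction `K_Y` does not increase `A^β`, by the ideal property. Conversely, by
maximality `A^β(T)` is the supremum of the norms of `Q_L T (I_{E₁} × ⋯ × I_{Eₙ})`. As `Y/L` is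
finite dimensional, hence reflexive, the bitranspose of `Q_L` gives an extension `S : Y** → Y/L` of
`Q_L` along `K_Y` with `‖S‖ ≤ 1`. So `Q_L T (I_{E₁} × ⋯ × I_{Eₙ})` equals
`S (K_Y T) (I_{E₁} × ⋯ × I_{Eₙ})`, whose norm is at most `A^β(K_Y T)` by the ideal property.
-/

namespace SigmaIdeals

section DoubleDual

theorem finrank_strongDual (𝕜 F : Type*) [NontriviallyNormedField 𝕜] [CompleteSpace 𝕜]
    [AddCommGroup F] [Module 𝕜 F] [TopologicalSpace F] [IsTopologicalAddGroup F]
    [ContinuousSMul 𝕜 F] [T2Space F] [FiniteDimensional 𝕜 F] :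
    Module.finrank 𝕜 (StrongDual 𝕜 F) = Module.finrank 𝕜 F :=
  (LinearMap.toContinuousLinearMap (𝕜 := 𝕜) (E := F) (F' := 𝕜)).finrank_eq.symm.trans
    Subspace.dual_finrank_eq

theorem norm_precomp_le {𝕜 E F : Type*} (G : Type*) [NontriviallyNormedField 𝕜]
    [SeminormedAddCommGroup E] [NormedSpace 𝕜 E] [SeminormedAddCommGroup F] [NormedSpace 𝕜 F]
    [SeminormedAddCommGroup G] [NormedSpace 𝕜 G] (Q : E →L[𝕜] F) :
    ‖(Q.precomp G : (F →L[𝕜] G) →L[𝕜] E →L[𝕜] G)‖ ≤ ‖Q‖ :=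
  ContinuousLinearMap.opNorm_le_bound _ (norm_nonneg Q) fun f =>
    (f.opNorm_comp_le Q).trans_eq (mul_comm _ _)

theorem norm_mkQL_le_one {𝕜 E : Type*} [NontriviallyNormedField 𝕜] [SeminormedAddCommGroup E]
    [NormedSpace 𝕜 E] (L : Submodule 𝕜 E) : ‖L.mkQL‖ ≤ 1 :=
  ContinuousLinearMap.opNorm_le_bound _ zero_le_one fun y =>
    (Submodule.Quotient.norm_mk_le L y).trans_eq (one_mul _).symm

variable {𝕜 : Type*} [RCLike 𝕜] {E F : Type*} [SeminormedAddCommGroup E] [NormedSpace 𝕜 E]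
  [NormedAddCommGroup F] [NormedSpace 𝕜 F] [FiniteDimensional 𝕜 F]

variable (𝕜 F) in
/-- The canonical isometric isomorphism of a finite dimensional space with its bidual. -/
noncomputable def doubleDualEquiv : F ≃ₗᵢ[𝕜] StrongDual 𝕜 (StrongDual 𝕜 F) :=
  (NormedSpace.inclusionInDoubleDualLi 𝕜).toLinearIsometryEquiv <| by
    rw [finrank_strongDual, finrank_strongDual]

set_option maxSynthPendingDepth 3 in
theorem exists_extension_doubleDual (Q : E →L[𝕜] F) :
    ∃ S : StrongDual 𝕜 (StrongDual 𝕜 E) →L[𝕜] F,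
      S ∘L NormedSpace.inclusionInDoubleDual 𝕜 E = Q ∧ ‖S‖ ≤ ‖Q‖ := by
  let bitranspose : StrongDual 𝕜 (StrongDual 𝕜 E) →L[𝕜] StrongDual 𝕜 (StrongDual 𝕜 F) :=
    (Q.precomp 𝕜).precomp 𝕜
  have norm_bitranspose : ‖bitranspose‖ ≤ ‖Q‖ :=
    (norm_precomp_le 𝕜 _).trans (norm_precomp_le 𝕜 Q)
  refine ⟨(doubleDualEquiv 𝕜 F).symm.toContinuousLinearEquiv ∘L bitranspose, ?_, ?_⟩
  · ext y
    exact (doubleDualEquiv 𝕜 F).symm_apply_apply (Q y)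
  · refine ContinuousLinearMap.opNorm_le_bound _ (norm_nonneg Q) fun φ => ?_
    calc ‖(doubleDualEquiv 𝕜 F).symm (bitranspose φ)‖
        = ‖bitranspose φ‖ := LinearIsometryEquiv.norm_map _ _
      _ ≤ ‖Q‖ * ‖φ‖ := bitranspose.le_of_opNorm_le norm_bitranspose φ

/-- The quotient maps of `E` by its closed finite codimensional subspaces extend along `K : E → F`
to contractions on `F`, as they do if `K` has a left inverse of norm at most one. -/
def ExtendsFiniteQuotients {𝕜 E F : Type*} [NontriviallyNormedField 𝕜] [SeminormedAddCommGroup E]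
    [NormedSpace 𝕜 E] [SeminormedAddCommGroup F] [NormedSpace 𝕜 F] (K : E →L[𝕜] F) : Prop :=
  ∀ L : Submodule 𝕜 E, IsClosed (L : Set E) → FiniteDimensional 𝕜 (E ⧸ L) →
    ∃ S : F →L[𝕜] E ⧸ L, S ∘L K = L.mkQL ∧ ‖S‖ ≤ 1

set_option maxSynthPendingDepth 3 in
variable (𝕜 E) in
theorem extendsFiniteQuotients_inclusionInDoubleDual :
    ExtendsFiniteQuotients (NormedSpace.inclusionInDoubleDual 𝕜 E) := fun L _ _ =>
  (exists_extension_doubleDual L.mkQL).imp fun _ hS => ⟨hS.1, hS.2.trans (norm_mkQL_le_one L)⟩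

end DoubleDual

section TensorMap

variable {𝕜 : Type} [RCLike 𝕜]

theorem opNormWrt_le_one {V W : Type*} [AddCommGroup V] [Module 𝕜 V] [AddCommGroup W] [Module 𝕜 W]
    {p : Seminorm 𝕜 V} {q : Seminorm 𝕜 W} {f : V →ₗ[𝕜] W} (h : ∀ v, q (f v) ≤ p v) :
    opNormWrt p q f ≤ 1 :=
  csInf_le ⟨0, fun _ hC => hC.1⟩ ⟨zero_le_one, by simpa only [one_mul] using h⟩

namespace SigmaOperator

variable {n : ℕ}
  {X : Fin n → Type u} [∀ i, NormedAddCommGroup (X i)] [∀ i, NormedSpace 𝕜 (X i)]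
  {Z : Fin n → Type u} [∀ i, NormedAddCommGroup (Z i)] [∀ i, NormedSpace 𝕜 (Z i)]
  {Y : Type u} [NormedAddCommGroup Y] [NormedSpace 𝕜 Y]
  {W : Type u} [NormedAddCommGroup W] [NormedSpace 𝕜 W]
  {θ : ReasonableCrossnorm 𝕜 Z} {β : ReasonableCrossnorm 𝕜 X}
  {u : ∀ i, Z i →L[𝕜] X i}

/-- The `Σ`-operator `(z¹, …, zⁿ) ↦ u₁ z¹ ⊗ ⋯ ⊗ uₙ zⁿ`, for operators `uᵢ` whose tensor product
`u₁ ⊗ ⋯ ⊗ uₙ` is a contraction from `θ` to `β`. -/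
noncomputable def ofContraction
    (hu : ∀ v, β (PiTensorProduct.map (fun i => (u i : Z i →ₗ[𝕜] X i)) v) ≤ θ v) :
    SigmaOperator θ β where
  toMultilinearMap := (PiTensorProduct.tprod 𝕜).compLinearMap fun i => (u i : Z i →ₗ[𝕜] X i)
  bounded := ⟨1, zero_le_one, fun v => (hu v).trans_eq (one_mul _).symm⟩
  mapsTo_segreCone := by
    rintro _ ⟨z, rfl⟩
    exact ⟨fun i => u i (z i), by simp⟩

theorem norm_ofContraction_le_one
    (hu : ∀ v, β (PiTensorProduct.map (fun i => (u i : Z i →ₗ[𝕜] X i)) v) ≤ θ v) :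
    (ofContraction hu).norm ≤ 1 :=
  opNormWrt_le_one hu

theorem sandwich_ofContraction
    (hu : ∀ v, β (PiTensorProduct.map (fun i => (u i : Z i →ₗ[𝕜] X i)) v) ≤ θ v)
    (T : ContinuousMultilinearMap 𝕜 X Y) (S : Y →L[𝕜] W) :
    (ofContraction hu).sandwich T S =
      S.compContinuousMultilinearMap (T.compContinuousLinearMap u) := by
  ext z
  exact congrArg S (linearization_tprod T fun i => u i (z i))

end SigmaOperator

end TensorMap

namespace SigmaIdeal

variable {𝕜 : Type} [RCLike 𝕜] {𝒜 : SigmaIdeal.{u} 𝕜} {n : ℕ} [NeZero n]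
  {X : Fin n → Type u} [∀ i, NormedAddCommGroup (X i)] [∀ i, NormedSpace 𝕜 (X i)]
  [∀ i, CompleteSpace (X i)]
  {Y : Type u} [NormedAddCommGroup Y] [NormedSpace 𝕜 Y] [CompleteSpace Y]
  {W : Type u} [NormedAddCommGroup W] [NormedSpace 𝕜 W] [CompleteSpace W]
  {β : ReasonableCrossnorm 𝕜 X} {T : ContinuousMultilinearMap 𝕜 X Y}

theorem extNorm_of_mem (hT : T ∈ 𝒜.comp β Y) :
    𝒜.extNorm β T = ENNReal.ofReal (𝒜.norm β Y ⟨T, hT⟩) :=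
  dif_pos hT

theorem extNorm_of_notMem (hT : T ∉ 𝒜.comp β Y) : 𝒜.extNorm β T = ∞ :=
  dif_neg hT

theorem extNorm_lt_top_iff : 𝒜.extNorm β T < ∞ ↔ T ∈ 𝒜.comp β Y := by
  by_cases hT : T ∈ 𝒜.comp β Y
  · simp [extNorm_of_mem, hT]
  · simp [extNorm_of_notMem, hT]

theorem toReal_extNorm (hT : T ∈ 𝒜.comp β Y) :
    (𝒜.extNorm β T).toReal = 𝒜.norm β Y ⟨T, hT⟩ := by
  rw [extNorm_of_mem hT, ENNReal.toReal_ofReal (apply_nonneg _ _)]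

theorem IsMaximal.extNorm_eq_maxNorm (h𝒜 : 𝒜.IsMaximal) (β : ReasonableCrossnorm 𝕜 X)
    (T : ContinuousMultilinearMap 𝕜 X Y) : 𝒜.extNorm β T = 𝒜.maxNorm β T := by
  obtain ⟨mem_iff, norm_eq⟩ := h𝒜 n X β Y T
  by_cases hT : T ∈ 𝒜.comp β Y
  · rw [extNorm_of_mem hT, norm_eq hT]
  · rw [extNorm_of_notMem hT, not_lt_top_iff.mp (mt mem_iff.mpr hT)]

theorem extNorm_sandwich_le {m : ℕ} [NeZero m] {Z : Fin m → Type u}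
    [∀ i, NormedAddCommGroup (Z i)] [∀ i, NormedSpace 𝕜 (Z i)] [∀ i, CompleteSpace (Z i)]
    {θ : ReasonableCrossnorm 𝕜 Z} {R : SigmaOperator θ β} (hR : R.norm ≤ 1)
    (T : ContinuousMultilinearMap 𝕜 X Y) {S : Y →L[𝕜] W} (hS : ‖S‖ ≤ 1) :
    𝒜.extNorm θ (R.sandwich T S) ≤ 𝒜.extNorm β T := by
  by_cases hT : T ∈ 𝒜.comp β Y
  · obtain ⟨hmem, hle⟩ := 𝒜.ideal β Y θ W R ⟨T, hT⟩ S
    rw [extNorm_of_mem hT, extNorm_of_mem hmem]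
    refine ENNReal.ofReal_le_ofReal (hle.trans ?_)
    calc R.norm * 𝒜.norm β Y ⟨T, hT⟩ * ‖S‖
        ≤ 1 * 𝒜.norm β Y ⟨T, hT⟩ * 1 := by gcongr
      _ = 𝒜.norm β Y ⟨T, hT⟩ := by rw [one_mul, mul_one]
  · exact extNorm_of_notMem hT ▸ le_top

theorem extNorm_compContinuousMultilinearMap_compContinuousLinearMap_le {Z : Fin n → Type u}
    [∀ i, NormedAddCommGroup (Z i)] [∀ i, NormedSpace 𝕜 (Z i)] [∀ i, CompleteSpace (Z i)]
    {θ : ReasonableCrossnorm 𝕜 Z} {u : ∀ i, Z i →L[𝕜] X i}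
    (hu : ∀ v, β (PiTensorProduct.map (fun i => (u i : Z i →ₗ[𝕜] X i)) v) ≤ θ v)
    (T : ContinuousMultilinearMap 𝕜 X Y) {S : Y →L[𝕜] W} (hS : ‖S‖ ≤ 1) :
    𝒜.extNorm θ (S.compContinuousMultilinearMap (T.compContinuousLinearMap u)) ≤
      𝒜.extNorm β T := by
  rw [← SigmaOperator.sandwich_ofContraction hu]
  exact extNorm_sandwich_le (SigmaOperator.norm_ofContraction_le_one hu) T hS

theorem extNorm_compContinuousMultilinearMap_le (T : ContinuousMultilinearMap 𝕜 X Y)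
    {S : Y →L[𝕜] W} (hS : ‖S‖ ≤ 1) :
    𝒜.extNorm β (S.compContinuousMultilinearMap T) ≤ 𝒜.extNorm β T :=
  extNorm_compContinuousMultilinearMap_compContinuousLinearMap_le (u := fun i => .id 𝕜 (X i))
    (fun v => by simp) T hS

theorem maxNorm_le_extNorm_compContinuousMultilinearMap (T : ContinuousMultilinearMap 𝕜 X Y)
    {K : Y →L[𝕜] W} (hK : ExtendsFiniteQuotients K) :
    𝒜.maxNorm β T ≤ 𝒜.extNorm β (K.compContinuousMultilinearMap T) := by
  refine iSup_le fun E => iSup_le fun hE => iSup_le fun L => iSup_le fun hL => iSup_le fun hQ => ?_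
  have (i : Fin n) : CompleteSpace (E i) := FiniteDimensional.complete 𝕜 (E i)
  obtain ⟨S, hSK, hS⟩ := hK L hL hQ
  have compress_eq : compress T E L = S.compContinuousMultilinearMap
      ((K.compContinuousMultilinearMap T).compContinuousLinearMap fun i => (E i).subtypeL) := by
    rw [compress, ← hSK]
    rfl
  rw [compressNorm, compress_eq]
  exact extNorm_compContinuousMultilinearMap_compContinuousLinearMap_le (fun _ => le_rfl) _ hS

theorem IsMaximal.extNorm_compContinuousMultilinearMap_eq (h𝒜 : 𝒜.IsMaximal)
    (β : ReasonableCrossnorm 𝕜 X) (T : ContinuousMultilinearMap 𝕜 X Y)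
    {K : Y →L[𝕜] W} (hK : ‖K‖ ≤ 1) (hK_ext : ExtendsFiniteQuotients K) :
    𝒜.extNorm β (K.compContinuousMultilinearMap T) = 𝒜.extNorm β T :=
  (extNorm_compContinuousMultilinearMap_le T hK).antisymm <|
    (h𝒜.extNorm_eq_maxNorm β T).trans_le (maxNorm_le_extNorm_compContinuousMultilinearMap T hK_ext)

end SigmaIdeal

end SigmaIdeals

theorem mainTheorem6_general {𝕜 : Type} [RCLike 𝕜] {𝒜 : SigmaIdeals.SigmaIdeal.{u} 𝕜}
    (h𝒜 : 𝒜.IsMaximal) {n : ℕ} [NeZero n] {X : Fin n → Type u}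
    [∀ i, NormedAddCommGroup (X i)] [∀ i, NormedSpace 𝕜 (X i)] [∀ i, CompleteSpace (X i)]
    {Y : Type u} [NormedAddCommGroup Y] [NormedSpace 𝕜 Y] [CompleteSpace Y]
    {W : Type u} [NormedAddCommGroup W] [NormedSpace 𝕜 W] [CompleteSpace W]
    (β : SigmaIdeals.ReasonableCrossnorm 𝕜 X) (T : ContinuousMultilinearMap 𝕜 X Y)
    {K : Y →L[𝕜] W} (hK : ‖K‖ ≤ 1) (hK_ext : SigmaIdeals.ExtendsFiniteQuotients K) :
    (T ∈ 𝒜.comp β Y ↔ K.compContinuousMultilinearMap T ∈ 𝒜.comp β W) ∧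
    ∀ (hT : T ∈ 𝒜.comp β Y) (hKT : K.compContinuousMultilinearMap T ∈ 𝒜.comp β W),
      𝒜.norm β Y ⟨T, hT⟩ = 𝒜.norm β W ⟨K.compContinuousMultilinearMap T, hKT⟩ := by
  have extNorm_eq := h𝒜.extNorm_compContinuousMultilinearMap_eq β T hK hK_ext
  refine ⟨?_, fun hT hKT => ?_⟩
  · rw [← SigmaIdeals.SigmaIdeal.extNorm_lt_top_iff, ← extNorm_eq,
      SigmaIdeals.SigmaIdeal.extNorm_lt_top_iff]
  · rw [← SigmaIdeals.SigmaIdeal.toReal_extNorm hT, ← extNorm_eq,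
      SigmaIdeals.SigmaIdeal.toReal_extNorm hKT]

theorem mainTheorem6 {𝕜 : Type} [RCLike 𝕜] (𝒜 : SigmaIdeals.SigmaIdeal.{u} 𝕜)
    (h𝒜 : 𝒜.IsMaximal) (n : ℕ) [NeZero n] (X : Fin n → Type u)
    [∀ i, NormedAddCommGroup (X i)] [∀ i, NormedSpace 𝕜 (X i)] [∀ i, CompleteSpace (X i)]
    (Y : Type u) [NormedAddCommGroup Y] [NormedSpace 𝕜 Y] [CompleteSpace Y]
    (β : SigmaIdeals.ReasonableCrossnorm 𝕜 X) (T : ContinuousMultilinearMap 𝕜 X Y) :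
    (T ∈ 𝒜.comp β Y ↔
      (NormedSpace.inclusionInDoubleDual 𝕜 Y).compContinuousMultilinearMap T ∈
        𝒜.comp β (StrongDual 𝕜 (StrongDual 𝕜 Y))) ∧
    ∀ (hT : T ∈ 𝒜.comp β Y)
      (hKT : (NormedSpace.inclusionInDoubleDual 𝕜 Y).compContinuousMultilinearMap T ∈
        𝒜.comp β (StrongDual 𝕜 (StrongDual 𝕜 Y))),
      𝒜.norm β Y ⟨T, hT⟩ =
        𝒜.norm β (StrongDual 𝕜 (StrongDual 𝕜 Y))
          ⟨(NormedSpace.inclusionInDoubleDual 𝕜 Y).compContinuousMultilinearMap T, hKT⟩ :=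
  mainTheorem6_general h𝒜 β T (NormedSpace.inclusionInDoubleDual_norm_le 𝕜 Y)
    (SigmaIdeals.extendsFiniteQuotients_inclusionInDoubleDual 𝕜 Y)
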